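/- **Setting.** Let $(W,\Sigma')$ and $(S,\Sigma)$ be measurable spaces and let $(P^w)_{w\in W}$ be probability measures on $(S,\Sigma)$ such that $w\mapsto P^w(A)$ is $\Sigma'$-measurable for every $A\in\Sigma$. Let $V_0$ be the set of random variables $v:W\times S\to\mathbb{R}$ that take finitely many values and whose conditional distribution functions $F_v(w,t)=P^w[v(w,\cdot)\le t]$ do not depend on $w$. Real numbers are identified with constant elements of $V_0$. An *objective event* is an $A\in\Sigma$ whose probability $P(A):=P^w(A)$ does not depend on $w$; for such $A$ and $t,x\in\mathbb{R}$ the bet $t\,A\,x:=t\,I_A+x\,I_{A^c}$ belongs to $V_0$. Let $\succeq$ be a binary relation on $V_0$, with strict part $\succ$ and indifference $\sim$. Suppose that $\succeq$ is a *biseparable preference*, that is, there are $\mathcal U:V_0\to\mathbb{R}$, not constant, with $v\succeq u\Leftrightarrow\mathcal U(v)\ge\mathcal U(u)$, and $\rho:[0,1]\to[0,1]$, neither identically $0$ nor identically $1$ on $(0,1)$, such that $\phi(t):=\mathcal U(t)$, $t\in\mathbb{R}$, is (strictly) increasing, $\mathcal U(\mathbb{R})$ is convex, and $$\mathcal U(t\,A\,x)=\phi(t)\,\rho(P(A))+\phi(x)\,\bigl(1-\rho(P(A))\bigr)$$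 for all $t\succeq x$ in $\mathbb{R}$ and all objective events $A$. Write $m_v\in\mathbb{R}$ for a certainty equivalent of $v$, i.e. $m_v\sim v$. Let $E$ be an *essential* event, i.e. an objective event with $t\succ t\,E\,x\succ x$ for some $t>x$. For $x,z\in\mathbb{R}$, $z$ is a *preference doubling* of $x$ (given $E$), written $z=2\otimes x$, if - in case $x\ge0$: $z\succeq x$ and $z\,E\,0\sim m_{zEx}\,E\,m_{xE0}$; - in case $x<0$: $x\succeq z$ and $0\,E\,z\sim m_{0Ex}\,E\,m_{xEz}$. **Proposition.** For every biseparable representation $(\mathcal U,\phi,\rho)$ of $\succeq$ as above and every essential event $E$: 1. For all $x,z\in\mathbb{R}$: $z=2\otimes x$ if and only if $\tfrac12\phi(z)+\tfrac12\phi(0)=\phi(x)$. 2. This is invariant under positive affine transformations of $\phi$: for all $a>0$ and $b\in\mathbb{R}$, $(a\,\mathcal U+b,\,a\phi+b,\,\rho)$ is again a biseparable representation of $\succeq$, and for all $x,z\in\mathbb{R}$, $z=2\otimes x$ if and only if $\tfrac12(a\phi(z)+b)+\tfrac12(a\phi(0)+b)=a\phi(x)+b$. 3. If $\phi(0)=0$,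 then $\phi(z)=2\phi(x)$ whenever $z=2\otimes x$. -/

import Mathlib

open MeasureTheory ProbabilityTheory

/-- The space `V₀`: random variables on `W × S` taking finitely many values whose conditional
CDF `F_v(w, t) = P^w[v^w ≤ t]` does not depend on the state of the world `w`.
The kernel `P` is the measurable family `w ↦ P^w`. -/
structure ObjRV {W S : Type*} [MeasurableSpace W] [MeasurableSpace S] (P : Kernel W S) where
  toFun : W × S → ℝ
  measurable' : Measurable toFun
  finite_range' : (Set.range toFun).Finite
  cdf_const' : ∀ (w₁ w₂ : W) (t : ℝ),
    P w₁ {s | toFun (w₁, s) ≤ t} = P w₂ {s | toFun (w₂, s) ≤ t}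

/-- Events `A ∈ Σ` whose probability `P(A)` is objectively given, that is, `P^w(A)` does not depend
on `w`. Exactly for these are all the bets `t A x` in `V₀`. -/
structure ObjEvent {W S : Type*} [MeasurableSpace W] [MeasurableSpace S] (P : Kernel W S) where
  carrier : Set S
  measurable' : MeasurableSet carrier
  prob_const' : ∀ w₁ w₂ : W, P w₁ carrier = P w₂ carrier

namespace ObjEvent

variable {W S : Type*} [MeasurableSpace W] [MeasurableSpace S] {P : Kernel W S}

/-- `P^w(A)` as an element of `[0,1]`; by definition of `ObjEvent` it is the same for all `w`. -/
noncomputable def prob [IsMarkovKernel P] (A : ObjEvent P) (w : W) : unitInterval :=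
  ⟨(P w).real A.carrier, measureReal_nonneg, measureReal_le_one⟩

open Classical in
/-- The bet `t A x = t I_A + x I_{Aᶜ}`, an element of `V₀`. -/
noncomputable def bet [IsMarkovKernel P] (t : ℝ) (A : ObjEvent P) (x : ℝ) : ObjRV P where
  toFun := fun p => if p.2 ∈ A.carrier then t else x
  measurable' :=
    Measurable.ite (measurable_snd A.measurable') measurable_const measurable_const
  finite_range' := by
    refine Set.Finite.subset (Set.toFinite {t, x}) ?_
    rintro _ ⟨p, rfl⟩
    by_cases hp : p.2 ∈ A.carrier <;> simp [hp]
  cdf_const' := by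
    intro w₁ w₂ r
    have hA := A.prob_const' w₁ w₂
    have hAc : P w₁ A.carrierᶜ = P w₂ A.carrierᶜ := by
      rw [prob_compl_eq_one_sub A.measurable', prob_compl_eq_one_sub A.measurable', hA]
    have key : ∀ w : W, {s | (if ((w, s) : W × S).2 ∈ A.carrier then t else x) ≤ r}
        = if t ≤ r then (if x ≤ r then Set.univ else A.carrier)
          else (if x ≤ r then A.carrierᶜ else ∅) := by
      intro w
      ext s
      by_cases hs : s ∈ A.carrier <;> by_cases ht : t ≤ r <;> by_cases hx : x ≤ r <;>
        simp [hs, ht, hx]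
    rw [key w₁]
    split_ifs <;> simp [hA, hAc]

end ObjEvent

/-- The sure payment `m ∈ ℝ` as an element of `V₀`. -/
def sure {W S : Type*} [MeasurableSpace W] [MeasurableSpace S] (P : Kernel W S)
    [IsMarkovKernel P] (m : ℝ) : ObjRV P where
  toFun := fun _ => m
  measurable' := measurable_const
  finite_range' := Set.Finite.subset (Set.finite_singleton m) (by rintro _ ⟨p, rfl⟩; simp)
  cdf_const' := by
    intro w₁ w₂ t
    by_cases h : m ≤ t <;> simp [h]

section Preference

variable {W S : Type*} [MeasurableSpace W] [MeasurableSpace S] {P : Kernel W S}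

/-- Strict preference `v ≻ u`. -/
def StrictPref (pref : ObjRV P → ObjRV P → Prop) (v u : ObjRV P) : Prop :=
  pref v u ∧ ¬ pref u v

/-- Indifference `v ∼ u`. -/
def Indiff (pref : ObjRV P → ObjRV P → Prop) (v u : ObjRV P) : Prop :=
  pref v u ∧ pref u v

variable [IsMarkovKernel P]

/-- `m` is a certainty equivalent `m_v` of `v`. -/
def IsCertEquiv (pref : ObjRV P → ObjRV P → Prop) (v : ObjRV P) (m : ℝ) : Prop :=
  Indiff pref (sure P m) v

/-- `E` is essential: `t ≻ t E x ≻ x` for some `t > x`. -/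
def IsEssential (pref : ObjRV P → ObjRV P → Prop) (E : ObjEvent P) : Prop :=
  ∃ t x : ℝ, x < t ∧ StrictPref pref (sure P t) (E.bet t x) ∧
    StrictPref pref (E.bet t x) (sure P x)

/-- `U` is a biseparable representation of the preference relation `pref` on `V₀`, with utility
function `φ` and weighting function `ρ`. -/
structure IsBiseparableRep (pref : ObjRV P → ObjRV P → Prop) (U : ObjRV P → ℝ) (φ : ℝ → ℝ)
    (ρ : unitInterval → unitInterval) : Prop where
  represents : ∀ v u : ObjRV P, pref v u ↔ U u ≤ U v
  nontrivial : ∃ v u : ObjRV P, U u < U v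
  utility : ∀ t : ℝ, φ t = U (sure P t)
  increasing : StrictMono φ
  weight_not_zero : ¬ ∀ p : unitInterval, 0 < p → p < 1 → ρ p = 0
  weight_not_one : ¬ ∀ p : unitInterval, 0 < p → p < 1 → ρ p = 1
  bet : ∀ t x : ℝ, pref (sure P t) (sure P x) → ∀ (A : ObjEvent P) (w : W),
    U (A.bet t x) = φ t * (ρ (A.prob w) : ℝ) + φ x * (1 - (ρ (A.prob w) : ℝ))
  convex_range : Convex ℝ (Set.range fun t : ℝ => U (sure P t))

/-- `z = 2 ⊗ x`: `z` is a preference doubling of `x`, given the event `E`. -/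
def IsDoubling (pref : ObjRV P → ObjRV P → Prop) (E : ObjEvent P) (z x : ℝ) : Prop :=
  (0 ≤ x → pref (sure P z) (sure P x) ∧
    ∃ m₁ m₂ : ℝ, IsCertEquiv pref (E.bet z x) m₁ ∧ IsCertEquiv pref (E.bet x 0) m₂ ∧
      Indiff pref (E.bet z 0) (E.bet m₁ m₂)) ∧
  (x < 0 → pref (sure P x) (sure P z) ∧
    ∃ m₁ m₂ : ℝ, IsCertEquiv pref (E.bet 0 x) m₁ ∧ IsCertEquiv pref (E.bet x z) m₂ ∧
      Indiff pref (E.bet 0 z) (E.bet m₁ m₂))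

end Preference

/-! Essentiality puts the weight `r` of `E` strictly between 0 and 1. For `s ≤ q ≤ p`, expanding `U
(E.bet p s)` and `U (E.bet m₁ m₂)`, with `m₁`, `m₂` certainty equivalents of `p E q` and `q E s`,
shows that they differ by `r (1 - r) (φ p + φ s - 2 φ q)`. So indifference means that `q` is the
utility midpoint, whatever `r` is (`tradeoff_iff`). Invariance holds because an affine transform is
itself a representation (`affine`), to which the same equivalence applies. -/

namespace IsBiseparableRep

variable {W S : Type*} [MeasurableSpace W] [MeasurableSpace S] {P : Kernel W S}
  [IsMarkovKernel P] {pref : ObjRV P → ObjRV P → Prop} {U : ObjRV P → ℝ} {φ : ℝ → ℝ}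
  {ρ : unitInterval → unitInterval}

theorem indiff_iff (h : IsBiseparableRep pref U φ ρ) (v u : ObjRV P) :
    Indiff pref v u ↔ U v = U u := by
  rw [Indiff, h.represents, h.represents, and_comm, le_antisymm_iff]

theorem strictPref_iff (h : IsBiseparableRep pref U φ ρ) (v u : ObjRV P) :
    StrictPref pref v u ↔ U u < U v := by
  rw [StrictPref, h.represents, h.represents, not_le]
  exact ⟨fun hv => hv.2, fun hv => ⟨hv.le, hv⟩⟩

theorem pref_sure_iff (h : IsBiseparableRep pref U φ ρ) (t x : ℝ) :
    pref (sure P t) (sure P x) ↔ x ≤ t := by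
  rw [h.represents, ← h.utility, ← h.utility, h.increasing.le_iff_le]

theorem isCertEquiv_iff (h : IsBiseparableRep pref U φ ρ) (v : ObjRV P) (m : ℝ) :
    IsCertEquiv pref v m ↔ φ m = U v := by
  rw [IsCertEquiv, h.indiff_iff, h.utility]

/-- A nonconstant utility on `V₀` forces the set of states of the world to be nonempty. -/
theorem nonempty_world (h : IsBiseparableRep pref U φ ρ) : Nonempty W := by
  by_contra hW
  rw [not_nonempty_iff] at hW
  obtain ⟨⟨f, _, _, _⟩, ⟨g, _, _, _⟩, hlt⟩ := h.nontrivial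
  -- With `W` empty so is `W × S`, hence `V₀` has only one element.
  obtain rfl : f = g := funext fun p => isEmptyElim p.1
  exact lt_irrefl _ hlt

/-- The decision weight of an essential event lies strictly between `0` and `1`. -/
theorem exists_weight (h : IsBiseparableRep pref U φ ρ) {E : ObjEvent P}
    (hE : IsEssential pref E) :
    ∃ r : ℝ, 0 < r ∧ r < 1 ∧
      ∀ t x : ℝ, x ≤ t → U (E.bet t x) = φ t * r + φ x * (1 - r) := by
  obtain ⟨w⟩ := h.nonempty_world
  have hbet : ∀ t x : ℝ, x ≤ t → U (E.bet t x) =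
      φ t * (ρ (E.prob w) : ℝ) + φ x * (1 - (ρ (E.prob w) : ℝ)) :=
    fun t x hx => h.bet t x ((h.pref_sure_iff t x).2 hx) E w
  obtain ⟨t, x, hxt, h₁, h₂⟩ := hE
  rw [h.strictPref_iff, hbet t x hxt.le, ← h.utility] at h₁ h₂
  have hφ := h.increasing hxt
  -- `h₂` says `0 < r (φ t - φ x)` and `h₁` says `0 < (1 - r) (φ t - φ x)`.
  exact ⟨_, by nlinarith, by nlinarith, hbet⟩

/-- Every bet on an essential event has a certainty equivalent. -/
theorem exists_certEquiv_bet (h : IsBiseparableRep pref U φ ρ) {E : ObjEvent P}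
    (hE : IsEssential pref E) {t x : ℝ} (hx : x ≤ t) :
    ∃ m : ℝ, IsCertEquiv pref (E.bet t x) m := by
  obtain ⟨r, h0, h1, hbet⟩ := h.exists_weight hE
  obtain ⟨m, hm⟩ := h.convex_range ⟨t, rfl⟩ ⟨x, rfl⟩ h0.le (sub_nonneg.2 h1.le)
    (add_sub_cancel r 1)
  refine ⟨m, (h.isCertEquiv_iff _ _).2 ?_⟩
  simp only [← h.utility, smul_eq_mul] at hm
  rw [hm, hbet t x hx]
  ring

/-- For `s ≤ q ≤ p`, the tradeoff condition `p E s ∼ m_{pEq} E m_{qEs}` says exactly that `q` is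
the utility midpoint of `p` and `s`. -/
theorem tradeoff_iff (h : IsBiseparableRep pref U φ ρ) {E : ObjEvent P}
    (hE : IsEssential pref E) {p q s : ℝ} (hqp : q ≤ p) (hsq : s ≤ q) :
    (∃ m₁ m₂ : ℝ, IsCertEquiv pref (E.bet p q) m₁ ∧ IsCertEquiv pref (E.bet q s) m₂ ∧
      Indiff pref (E.bet p s) (E.bet m₁ m₂)) ↔ 1 / 2 * φ p + 1 / 2 * φ s = φ q := by
  obtain ⟨r, h0, h1, hbet⟩ := h.exists_weight hE
  have hφqp := h.increasing.monotone hqp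
  have hφsq := h.increasing.monotone hsq
  have key : ∀ m₁ m₂ : ℝ, IsCertEquiv pref (E.bet p q) m₁ → IsCertEquiv pref (E.bet q s) m₂ →
      (Indiff pref (E.bet p s) (E.bet m₁ m₂) ↔ 1 / 2 * φ p + 1 / 2 * φ s = φ q) := by
    intro m₁ m₂ hm₁ hm₂
    rw [h.isCertEquiv_iff, hbet _ _ hqp] at hm₁
    rw [h.isCertEquiv_iff, hbet _ _ hsq] at hm₂
    -- The bet formula needs ordered payoffs: `φ m₂ ≤ φ q ≤ φ m₁`.
    have hm : m₂ ≤ m₁ := h.increasing.le_iff_le.1 (by rw [hm₁, hm₂]; nlinarith)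
    rw [h.indiff_iff, hbet _ _ (hsq.trans hqp), hbet _ _ hm, hm₁, hm₂]
    have hr : 2 * (r * (1 - r)) ≠ 0 := (by nlinarith : 0 < 2 * (r * (1 - r))).ne'
    constructor
    · intro heq
      apply mul_left_cancel₀ hr
      linear_combination heq
    · intro heq
      linear_combination 2 * (r * (1 - r)) * heq
  constructor
  · rintro ⟨m₁, m₂, hm₁, hm₂, hind⟩
    exact (key m₁ m₂ hm₁ hm₂).1 hind
  · intro heq
    obtain ⟨m₁, hm₁⟩ := h.exists_certEquiv_bet hE hqp
    obtain ⟨m₂, hm₂⟩ := h.exists_certEquiv_bet hE hsq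
    exact ⟨m₁, m₂, hm₁, hm₂, (key m₁ m₂ hm₁ hm₂).2 heq⟩

/-- This is `tradeoff_iff` at `(p, q, s) = (z, x, 0)` or `(0, x, z)`, by the sign of `x`; the
midpoint equation forces the required order of `z` and `x`. -/
theorem isDoubling_iff (h : IsBiseparableRep pref U φ ρ) {E : ObjEvent P}
    (hE : IsEssential pref E) (z x : ℝ) :
    IsDoubling pref E z x ↔ 1 / 2 * φ z + 1 / 2 * φ 0 = φ x := by
  rw [IsDoubling, h.pref_sure_iff, h.pref_sure_iff]
  rcases le_or_gt 0 x with hx | hx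
  · simp only [hx, hx.not_gt, true_imp_iff, false_imp_iff, and_true]
    constructor
    · rintro ⟨hz, ht⟩
      exact (h.tradeoff_iff hE hz hx).1 ht
    · intro heq
      have hz : x ≤ z := h.increasing.le_iff_le.1 (by linarith [h.increasing.monotone hx])
      exact ⟨hz, (h.tradeoff_iff hE hz hx).2 heq⟩
  · simp only [hx, hx.not_ge, true_imp_iff, false_imp_iff, true_and]
    -- For losses the best payoff is `0`, so it takes the role of `p`.
    rw [add_comm]
    constructor
    · rintro ⟨hz, ht⟩
      exact (h.tradeoff_iff hE hx.le hz).1 ht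
    · intro heq
      have hz : z ≤ x := h.increasing.le_iff_le.1 (by linarith [h.increasing hx])
      exact ⟨hz, (h.tradeoff_iff hE hx.le hz).2 heq⟩

/-- Biseparable representations are stable under positive affine transformations. -/
theorem affine (h : IsBiseparableRep pref U φ ρ) {a : ℝ} (ha : 0 < a) (b : ℝ) :
    IsBiseparableRep pref (fun v => a * U v + b) (fun t => a * φ t + b) ρ where
  represents v u := by
    rw [h.represents, add_le_add_iff_right, mul_le_mul_iff_right₀ ha]
  nontrivial := by
    obtain ⟨v, u, hvu⟩ := h.nontrivial
    exact ⟨v, u, by gcongr⟩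
  utility t := by rw [h.utility]
  increasing t x htx := by
    have := h.increasing htx
    dsimp only
    gcongr
  weight_not_zero := h.weight_not_zero
  weight_not_one := h.weight_not_one
  bet t x hx A w := by
    rw [h.bet t x hx A w]
    ring
  convex_range := by
    rintro _ ⟨t, rfl⟩ _ ⟨x, rfl⟩ c d hc hd hcd
    obtain ⟨m, hm⟩ := h.convex_range ⟨t, rfl⟩ ⟨x, rfl⟩ hc hd hcd
    refine ⟨m, ?_⟩
    simp only [smul_eq_mul] at hm ⊢
    -- The weights sum to 1, so the shift `b` survives the mixture.
    linear_combination a * hm - b * hcd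

end IsBiseparableRep

theorem mainTheorem6 {W S : Type*} [MeasurableSpace W] [MeasurableSpace S]
    (P : Kernel W S) [IsMarkovKernel P]
    (pref : ObjRV P → ObjRV P → Prop)
    (U : ObjRV P → ℝ) (φ : ℝ → ℝ) (ρ : unitInterval → unitInterval)
    (hrep : IsBiseparableRep pref U φ ρ)
    (E : ObjEvent P) (hE : IsEssential pref E) :
    (∀ z x : ℝ, IsDoubling pref E z x ↔ 1 / 2 * φ z + 1 / 2 * φ 0 = φ x) ∧
    (∀ a b : ℝ, 0 < a →
      IsBiseparableRep pref (fun v => a * U v + b) (fun t => a * φ t + b) ρ ∧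
      ∀ z x : ℝ, IsDoubling pref E z x ↔
        1 / 2 * (a * φ z + b) + 1 / 2 * (a * φ 0 + b) = a * φ x + b) ∧
    (φ 0 = 0 → ∀ z x : ℝ, IsDoubling pref E z x → φ z = 2 * φ x) := by
  refine ⟨hrep.isDoubling_iff hE, fun a b ha => ⟨hrep.affine ha b,
    (hrep.affine ha b).isDoubling_iff hE⟩, fun h0 z x hzx => ?_⟩
  have := (hrep.isDoubling_iff hE z x).1 hzx
  linarith
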